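/- Let $D$ and $E$ be $qcb_0$ spaces, i.e. $T_0$ topological quotients of countably based spaces; for instance countably based topological predomains. (A topological predomain is a $qcb_0$ space in which every ascending chain for the specialization order converges to some upper bound of the chain.) Let $2^\omega$ be the Cantor space of bit-streams, with the distribution $\mu_{\mathrm{fair}}$ of independent fair bits. Let $D_\bot$ be the lift of $D$, whose open sets are $\{\lfloor d\rfloor : d\in U\}$ for $U\subseteq D$ open, together with $D_\bot$ itself. A sampler on $D$ is a continuous map $2^\omega\to D_\bot$, and $S(D)$ is the space of samplers with the compact-open topology (for continuity of maps from a $qcb_0$ space into $S(D)$ this agrees with the exponential in the category of $qcb_0$ spaces). Let $P(D)$ be the space of $\omega$-continuous valuations on $D$, i.e. maps $\nu$ from the open sets of $D$ to $[0,1]$ that are strict ($\nu(\emptyset)=0$), monotone, modular ($\nu(U)+\nu(V)=\nu(U\cup V)+\nu(U\cap V)$) and satisfy $\nu(\bigcup_n V_n)=\sup_n\nu(V_n)$ for increasing sequences $(V_n)$ of open sets; $P(D)$ carries the topology generated by the sets $\{\nu : \nu(U)>r\}$. Define the following. - For $d\in D$, $\mathrm{det}(d)\in S(D)$ is the constant map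 $u\mapsto\lfloor d\rfloor$. - For $s\in S(D)$ and a continuous $f:D\to S(E)$, the sampler $\mathrm{samp}(s)(f)\in S(E)$ sends $u$ to $f(d)(u_o)$ if $s(u_e)=\lfloor d\rfloor$, and to $\bot$ if $s(u_e)=\bot$, where $u_e$ and $u_o$ are the streams of the even-indexed and the odd-indexed bits of $u$. - $\mathrm{push}_D:S(D)\to P(D)$ is the continuous map $\mathrm{push}_D(s)(U)=\mu_{\mathrm{fair}}\{u : s(u)=\lfloor d\rfloor\text{ for some }d\in U\}$. - For $d\in D$, $\mathrm{ret}(d)\in P(D)$ is $\mathrm{ret}(d)(U)=1_U(d)$. - For $\mu\in P(D)$ and a continuous $g:D\to P(E)$, the valuation $\mu\gg\!=g\in P(E)$ is $(\mu\gg\!=g)(U)=\int g(x)(U)\,d\mu(x)$, where the integral of a function $h:D\to[0,\infty]$ is the supremum of $\sum_i c_i\,\mu(V_i)$ over all finite sums $\sum_i c_i 1_{V_i}\le h$ with $c_i\ge 0$ and $V_i$ open. Then: 1. $\mathrm{push}_D(\mathrm{det}(d))=\mathrm{ret}(d)$ for every $d\in D$; 2. $\mathrm{push}_E(\mathrm{samp}(s)(f))=\mathrm{push}_D(s)\gg\!=\bigl(v\mapsto\mathrm{push}_E(f(v))\bigr)$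 for every $s\in S(D)$ and every continuous $f:D\to S(E)$. -/

import Mathlib

open Set Filter Topology TopologicalSpace MeasureTheory
open scoped ENNReal NNReal

universe u v

namespace SamplerSemantics

/-! ### Spaces -/

/-- A `qcb₀` space: a `T₀` topological quotient of a countably based space. -/
class QCB0Space (X : Type u) [TopologicalSpace X] : Prop where
  t0 : T0Space X
  exists_quotient : ∃ (Y : Type u) (_ : TopologicalSpace Y), SecondCountableTopology Y ∧
    ∃ q : Y → X, IsQuotientMap q

/-- A topological predomain: a `qcb₀` space in which every ascending chain for the specialization
order (`x` is below `y` when every open set containing `x` contains `y`, that is `y ⤳ x`)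
has an upper bound to which it converges. -/
class TopologicalPredomain (X : Type u) [TopologicalSpace X] : Prop extends QCB0Space X where
  exists_limit : ∀ x : ℕ → X, (∀ i, x (i + 1) ⤳ x i) →
    ∃ y : X, (∀ i, y ⤳ x i) ∧ Tendsto x atTop (𝓝 y)

instance (X : Type u) [TopologicalSpace X] [T0Space X] [SecondCountableTopology X] :
    QCB0Space X :=
  ⟨inferInstance, X, inferInstance, inferInstance, id, IsQuotientMap.id⟩

/-- The lift `D_⊥` of `D`: a least element `bot` is adjoined. -/
inductive Lift (D : Type u) : Type u
  | bot : Lift D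
  | up : D → Lift D

/-- The open sets of `D_⊥` are the (images of) open sets of `D`, and the whole space. -/
instance {D : Type u} [TopologicalSpace D] : TopologicalSpace (Lift D) where
  IsOpen V := IsOpen (Lift.up ⁻¹' V) ∧ (Lift.bot ∈ V → V = univ)
  isOpen_univ := ⟨isOpen_univ, fun _ => rfl⟩
  isOpen_inter V W hV hW := ⟨hV.1.inter hW.1, fun h => by
    rw [hV.2 h.1, hW.2 h.2, inter_univ]⟩
  isOpen_sUnion S hS := by
    refine ⟨?_, ?_⟩
    · rw [preimage_sUnion]
      exact isOpen_biUnion fun V hV => (hS V hV).1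
    · rintro ⟨V, hV, hb⟩
      exact eq_univ_of_univ_subset ((hS V hV).2 hb ▸ subset_sUnion_of_mem hV)

theorem Lift.isOpen_iff {D : Type u} [TopologicalSpace D] {V : Set (Lift D)} :
    IsOpen V ↔ IsOpen (Lift.up ⁻¹' V) ∧ (Lift.bot ∈ V → V = univ) := Iff.rfl

theorem Lift.isOpen_up_image {D : Type u} [TopologicalSpace D] (U : Opens D) :
    IsOpen (Lift.up '' (U : Set D)) := by
  refine Lift.isOpen_iff.2 ⟨?_, ?_⟩
  · rw [preimage_image_eq _ (fun a b h => by injection h)]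
    exact U.isOpen
  · rintro ⟨d, _, h⟩
    cases h

theorem Lift.specializes_bot {D : Type u} [TopologicalSpace D] (x : Lift D) :
    x ⤳ Lift.bot := by
  refine specializes_iff_forall_open.2 fun V hV hb => ?_
  rw [(Lift.isOpen_iff.1 hV).2 hb]
  trivial

/-! ### Samplers -/

/-- Bit-streams; the topology is the product (Cantor) topology. -/
abbrev Bits : Type := ℕ → Bool

/-- The distribution of a stream of independent fair bits. -/
noncomputable def fair : Measure Bits :=
  Measure.infinitePi fun _ : ℕ => (PMF.uniformOfFintype Bool).toMeasure

instance : IsProbabilityMeasure fair := by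
  unfold fair
  infer_instance

/-- Samplers on `D`: continuous maps from bit-streams to `D_⊥`. The topology is the compact-open
one; a map into it from a `qcb₀` space is continuous exactly when it is continuous for the
exponential in the category of `qcb₀` spaces. -/
abbrev Samp (D : Type u) [TopologicalSpace D] : Type u := C(Bits, Lift D)

variable {D : Type u} {E : Type v} [TopologicalSpace D] [TopologicalSpace E]

/-- The sampler that ignores its input and returns `d`. -/
def det (d : D) : Samp D := ContinuousMap.const Bits (Lift.up d)

/-- The split of a bit-stream into its even-indexed and its odd-indexed bits. -/
def split : C(Bits, Bits × Bits) where
  toFun u := (fun n => u (2 * n), fun n => u (2 * n + 1))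
  continuous_toFun := by fun_prop

/-- The extension of `f : D → Samp E` to `D_⊥` that sends `⊥` to the least sampler, which maps
every bit-stream to `⊥`. -/
def liftDom (f : C(D, Samp E)) : C(Lift D, Samp E) where
  toFun
    | Lift.bot => ContinuousMap.const Bits Lift.bot
    | Lift.up d => f d
  continuous_toFun := by
    refine continuous_def.2 fun V hV => Lift.isOpen_iff.2 ⟨hV.preimage f.continuous, fun hb => ?_⟩
    have hbot : ∀ t : Samp E, t ⤳ ContinuousMap.const Bits Lift.bot := fun t =>
      ContinuousMap.specializes_coe.1 (specializes_pi.2 fun u => Lift.specializes_bot (t u))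
    exact eq_univ_of_forall fun x => (hbot _).mem_open hV hb

/-- Sequencing of samplers: split the input, run `s` on the even bits, and run the sampler that
`f` returns on the odd bits. -/
def samp (s : Samp D) (f : C(D, Samp E)) : Samp E :=
  (liftDom f).uncurry.comp
    (((s.comp ContinuousMap.fst).prodMk ContinuousMap.snd).comp split)

/-! ### Valuations -/

/-- An `ω`-continuous valuation on the open sets of `X` with values in `[0, 1]`. -/
@[ext]
structure OmegaValuation (X : Type u) [TopologicalSpace X] where
  val : Opens X → ℝ≥0∞
  le_one : ∀ U, val U ≤ 1
  strict : val ⊥ = 0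
  mono : Monotone val
  modular : ∀ U V, val U + val V = val (U ⊔ V) + val (U ⊓ V)
  omega : ∀ V : ℕ → Opens X, Monotone V → val (⨆ n, V n) = ⨆ n, val (V n)

namespace OmegaValuation

/-- The weak topology, generated by the sets `{ν | r < ν U}`. -/
instance {X : Type u} [TopologicalSpace X] : TopologicalSpace (OmegaValuation X) :=
  generateFrom {S | ∃ (U : Opens X) (r : ℝ≥0∞), S = {ν | r < ν.val U}}

/-- The integral of `g` against a valuation: the supremum of `∑ i, c i * ν (V i)` over all simple
functions `∑ i, c i • 1_{V i}`, with `V i` open, that lie below `g`. -/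
noncomputable def integral (ν : OmegaValuation D) (g : D → ℝ≥0∞) : ℝ≥0∞ :=
  ⨆ (n : ℕ) (c : Fin n → ℝ≥0) (V : Fin n → Opens D)
    (_ : ∀ x, ∑ i, (V i : Set D).indicator (fun _ => (c i : ℝ≥0∞)) x ≤ g x),
    ∑ i, (c i : ℝ≥0∞) * ν.val (V i)

open Classical in
/-- The point-mass valuation `U ↦ 1_U(x)`. -/
noncomputable def ret (x : D) : OmegaValuation D where
  val U := if x ∈ U then 1 else 0
  le_one U := by split_ifs <;> simp
  strict := by simp
  mono U V h := by
    dsimp only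
    by_cases hx : x ∈ U
    · simp [hx, h hx]
    · simp [hx]
  modular U V := by
    by_cases hU : x ∈ U <;> by_cases hV : x ∈ V <;> simp [hU, hV]
  omega V _ := by
    by_cases h : ∃ n, x ∈ V n
    · rw [if_pos (Opens.mem_iSup.2 h)]
      obtain ⟨n, hn⟩ := h
      refine le_antisymm (le_iSup_of_le n (by simp [hn])) (iSup_le fun n => ?_)
      split_ifs <;> simp
    · rw [if_neg (fun h' => h (Opens.mem_iSup.1 h'))]
      push Not at h
      simp [h]

/-! The layer-cake form of the integral, used to see that `bind` below is a valuation. -/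

/-- The valuation of the interior of a set. -/
noncomputable def onSet (ν : OmegaValuation D) (S : Set D) : ℝ≥0∞ := ν.val (Opens.interior S)

theorem onSet_mono (ν : OmegaValuation D) {S T : Set D} (h : S ⊆ T) : ν.onSet S ≤ ν.onSet T :=
  ν.mono (interior_mono h)

theorem onSet_coe (ν : OmegaValuation D) (U : Opens D) : ν.onSet U = ν.val U := by
  have h : Opens.interior (U : Set D) = U := Opens.ext U.isOpen.interior_eq
  rw [onSet, h]

theorem onSet_empty (ν : OmegaValuation D) : ν.onSet ∅ = 0 := by
  rw [← ν.strict, ← Opens.coe_bot, onSet_coe]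

theorem onSet_le_one (ν : OmegaValuation D) (S : Set D) : ν.onSet S ≤ 1 := ν.le_one _

theorem onSet_modular (ν : OmegaValuation D) {S T : Set D} (hS : IsOpen S) (hT : IsOpen T) :
    ν.onSet S + ν.onSet T = ν.onSet (S ∪ T) + ν.onSet (S ∩ T) := by
  have := ν.modular ⟨S, hS⟩ ⟨T, hT⟩
  simpa only [← onSet_coe, Opens.coe_sup, Opens.coe_inf, Opens.coe_mk] using this

/-- The layer-cake integral of a nonnegative real function. -/
noncomputable def layer (ν : OmegaValuation D) (g : D → ℝ) : ℝ≥0∞ :=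
  ∫⁻ t in Ioi (0 : ℝ), ν.onSet {x | t < g x}

theorem layer_mono (ν : OmegaValuation D) {g h : D → ℝ} (hgh : ∀ x, g x ≤ h x) :
    ν.layer g ≤ ν.layer h :=
  lintegral_mono fun _ => ν.onSet_mono fun x hx => lt_of_lt_of_le hx (hgh x)

theorem antitone_onSet (ν : OmegaValuation D) (g : D → ℝ) (A : Set D) :
    Antitone fun t : ℝ => ν.onSet ({x | t < g x} ∩ A) := fun _ _ hst =>
  ν.onSet_mono fun _ hx => ⟨lt_of_le_of_lt hst hx.1, hx.2⟩

theorem antitone_onSet' (ν : OmegaValuation D) (g : D → ℝ) :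
    Antitone fun t : ℝ => ν.onSet {x | t < g x} := fun _ _ hst =>
  ν.onSet_mono fun _ hx => lt_of_le_of_lt hst hx

theorem lintegral_ne_top (ν : OmegaValuation D) {g : D → ℝ} {M : ℝ} (hM : ∀ x, g x ≤ M)
    (A : Set D) : ∫⁻ t in Ioi (0 : ℝ), ν.onSet ({x | t < g x} ∩ A) ≠ ∞ := by
  refine ne_top_of_le_ne_top (b := ∫⁻ t : ℝ, (Ioc (0 : ℝ) M).indicator 1 t) ?_ ?_
  · rw [lintegral_indicator_one measurableSet_Ioc]
    simp
  · rw [← lintegral_indicator measurableSet_Ioi]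
    refine lintegral_mono fun t => ?_
    by_cases ht : t ∈ Ioc (0 : ℝ) M
    · rw [indicator_of_mem (show t ∈ Ioi (0 : ℝ) from ht.1), indicator_of_mem ht]
      exact ν.onSet_le_one _
    · by_cases h0 : t ∈ Ioi (0 : ℝ)
      · have : {x | t < g x} ∩ A = ∅ := by
          ext x
          simp only [mem_inter_iff, mem_ofPred_eq, mem_empty_iff_false, iff_false, not_and]
          intro hx
          exact absurd ⟨h0, hx.le.trans (hM x)⟩ ht
        rw [indicator_of_mem h0, this, onSet_empty]
        exact zero_le
      · rw [indicator_of_notMem h0]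
        exact zero_le

theorem layer_add_indicator (ν : OmegaValuation D) {s : D → ℝ} (hs : LowerSemicontinuous s)
    (h0 : ∀ x, 0 ≤ s x) {M : ℝ} (hM : ∀ x, s x ≤ M) (U : Opens D) (c : ℝ≥0) :
    ν.layer (fun x => s x + (U : Set D).indicator (fun _ => (c : ℝ)) x) =
      ν.layer s + c * ν.val U := by
  have hop : ∀ t : ℝ, IsOpen {x | t < s x} := fun t => hs.isOpen_preimage t
  have key : ∀ t : ℝ, ν.onSet {x | t < s x} + ν.onSet ({x | t - c < s x} ∩ U) =
      ν.onSet {x | t < s x + (U : Set D).indicator (fun _ => (c : ℝ)) x} +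
        ν.onSet ({x | t < s x} ∩ U) := by
    intro t
    rw [ν.onSet_modular (hop t) ((hop _).inter U.isOpen)]
    congr 2
    · ext x
      by_cases hx : x ∈ (U : Set D)
      · simp only [mem_union, mem_ofPred_eq, mem_inter_iff, hx, indicator_of_mem]
        have : (0 : ℝ) ≤ c := c.2
        constructor
        · rintro (h | h)
          · linarith
          · linarith [h.1]
        · intro h
          exact Or.inr ⟨by linarith, trivial⟩
      · simp [hx]
    · ext x
      simp only [mem_inter_iff, mem_ofPred_eq]
      have : (0 : ℝ) ≤ c := c.2
      constructor
      · rintro ⟨h, -, h'⟩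
        exact ⟨h, h'⟩
      · rintro ⟨h, h'⟩
        exact ⟨h, by linarith, h'⟩
  have hm : ∀ A : Set D, Measurable fun t : ℝ => ν.onSet ({x | t < s x} ∩ A) := fun A =>
    (ν.antitone_onSet s A).measurable
  have hshift : ∫⁻ t in Ioi (0 : ℝ), ν.onSet ({x | t - c < s x} ∩ U) =
      c * ν.val U + ∫⁻ t in Ioi (0 : ℝ), ν.onSet ({x | t < s x} ∩ U) := by
    have h1 : ∫⁻ t in Ioi (0 : ℝ), ν.onSet ({x | t - c < s x} ∩ U) =
        ∫⁻ t in Ioi (-c : ℝ), ν.onSet ({x | t < s x} ∩ U) := by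
      rw [← lintegral_indicator measurableSet_Ioi, ← lintegral_indicator measurableSet_Ioi,
        ← lintegral_sub_right_eq_self ((Ioi (-c : ℝ)).indicator _) (c : ℝ)]
      refine lintegral_congr fun t => ?_
      by_cases ht : 0 < t
      · rw [indicator_of_mem (show t ∈ Ioi (0 : ℝ) from ht),
          indicator_of_mem (show t - c ∈ Ioi (-c : ℝ) by simpa using ht)]
      · rw [indicator_of_notMem (show t ∉ Ioi (0 : ℝ) from ht),
          indicator_of_notMem (show t - c ∉ Ioi (-c : ℝ) by simpa using ht)]
    have h2 : Ioi (-c : ℝ) = Ioc (-c : ℝ) 0 ∪ Ioi 0 :=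
      (Ioc_union_Ioi_eq_Ioi (by simp)).symm
    rw [h1, h2, lintegral_union measurableSet_Ioi
      (Set.disjoint_left.2 fun x hx hx' => not_lt.2 hx.2 hx')]
    have h3 : ∫⁻ t in Ioc (-c : ℝ) 0, ν.onSet ({x | t < s x} ∩ U) =
        ∫⁻ _ in Ioo (-c : ℝ) 0, ν.val U := by
      rw [← setLIntegral_congr (Ioo_ae_eq_Ioc (a := (-c : ℝ)) (b := 0))]
      refine setLIntegral_congr_fun measurableSet_Ioo fun t ht => ?_
      have : {x | t < s x} ∩ (U : Set D) = U :=
        inter_eq_right.2 fun x _ => lt_of_lt_of_le ht.2 (h0 x)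
      simp only [this, onSet_coe]
    rw [h3, setLIntegral_const, Real.volume_Ioo, mul_comm]
    simp
  have hint := lintegral_congr (μ := volume.restrict (Ioi (0 : ℝ))) key
  rw [lintegral_add_left (ν.antitone_onSet' s).measurable, lintegral_add_right _ (hm U), hshift,
    ← add_assoc] at hint
  exact ((ENNReal.add_left_inj (ν.lintegral_ne_top hM U)).1 hint).symm

theorem layer_add_simple (ν : OmegaValuation D) {n : ℕ} (c : Fin n → ℝ≥0) (V : Fin n → Opens D)
    {s : D → ℝ} (hs : LowerSemicontinuous s) (h0 : ∀ x, 0 ≤ s x) {M : ℝ} (hM : ∀ x, s x ≤ M)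
    (F : Finset (Fin n)) :
    ν.layer (fun x => s x + ∑ i ∈ F, (V i : Set D).indicator (fun _ => (c i : ℝ)) x) =
      ν.layer s + ∑ i ∈ F, c i * ν.val (V i) := by
  classical
  have hnn : ∀ i x, 0 ≤ (V i : Set D).indicator (fun _ => (c i : ℝ)) x := fun i x =>
    indicator_nonneg (fun _ _ => (c i).2) x
  have hle : ∀ i x, (V i : Set D).indicator (fun _ => (c i : ℝ)) x ≤ c i := fun i x =>
    indicator_le_self' (fun _ _ => (c i).2) x
  induction F using Finset.induction_on with
  | empty => simp
  | insert a F ha ih =>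
    have hlsc : LowerSemicontinuous fun x =>
        s x + ∑ i ∈ F, (V i : Set D).indicator (fun _ => (c i : ℝ)) x :=
      hs.add (lowerSemicontinuous_sum fun i _ => (V i).isOpen.lowerSemicontinuous_indicator (c i).2)
    have := ν.layer_add_indicator hlsc
      (fun x => add_nonneg (h0 x) (Finset.sum_nonneg fun i _ => hnn i x))
      (M := M + ∑ i ∈ F, (c i : ℝ))
      (fun x => add_le_add (hM x) (Finset.sum_le_sum fun i _ => hle i x)) (V a) (c a)
    rw [Finset.sum_insert ha, add_left_comm, add_comm, ← ih, ← this]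
    congr 1
    ext x
    rw [Finset.sum_insert ha]
    ring

theorem layer_zero (ν : OmegaValuation D) : ν.layer (fun _ => 0) = 0 := by
  rw [layer, ← lintegral_indicator measurableSet_Ioi, ← lintegral_zero (μ := (volume : Measure ℝ))]
  refine lintegral_congr fun t => ?_
  by_cases ht : t ∈ Ioi (0 : ℝ)
  · have : {x : D | t < (fun _ => (0 : ℝ)) x} = ∅ := by
      ext x
      simpa using le_of_lt ht
    rw [indicator_of_mem ht, this, onSet_empty]
  · rw [indicator_of_notMem ht]

theorem layer_simple (ν : OmegaValuation D) {n : ℕ} (c : Fin n → ℝ≥0) (V : Fin n → Opens D) :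
    ν.layer (fun x => ∑ i, (V i : Set D).indicator (fun _ => (c i : ℝ)) x) =
      ∑ i, c i * ν.val (V i) := by
  have := ν.layer_add_simple c V (s := fun _ => 0) lowerSemicontinuous_const (fun _ => le_rfl)
    (M := 0) (fun _ => le_rfl) Finset.univ
  simpa [layer_zero] using this

theorem exists_simple {g : D → ℝ} (hg : LowerSemicontinuous g) (h0 : ∀ x, 0 ≤ g x)
    (h1 : ∀ x, g x ≤ 1) (n : ℕ) (hn : 0 < n) :
    ∃ (c : Fin n → ℝ≥0) (V : Fin n → Opens D),
      (∀ x, ∑ i, (V i : Set D).indicator (fun _ => (c i : ℝ)) x ≤ g x) ∧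
      ∀ x, g x ≤ ∑ i, (V i : Set D).indicator (fun _ => (c i : ℝ)) x + 1 / n := by
  classical
  have hn' : (0 : ℝ) < n := by exact_mod_cast hn
  refine ⟨fun _ => (n : ℝ≥0)⁻¹, fun i => ⟨_, hg.isOpen_preimage ((i + 1 : ℝ) / n)⟩, ?_⟩
  have key : ∀ x, ∑ i : Fin n, (g ⁻¹' Ioi ((i + 1 : ℝ) / n)).indicator
      (fun _ => (((n : ℝ≥0)⁻¹ : ℝ≥0) : ℝ)) x = ((⌈n * g x⌉₊ - 1 : ℕ) : ℝ) / n := by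
    intro x
    have hf : ∀ i : ℕ, (g ⁻¹' Ioi ((i + 1 : ℝ) / n)).indicator
        (fun _ => (((n : ℝ≥0)⁻¹ : ℝ≥0) : ℝ)) x = if i < ⌈n * g x⌉₊ - 1 then (n : ℝ)⁻¹ else 0 := by
      intro i
      have : x ∈ g ⁻¹' Ioi ((i + 1 : ℝ) / n) ↔ i < ⌈n * g x⌉₊ - 1 := by
        rw [Nat.lt_sub_iff_add_lt, Nat.lt_ceil, mem_preimage, mem_Ioi, div_lt_iff₀ hn', mul_comm]
        push_cast
        rfl
      simp only [indicator, this]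
      simp
    rw [Fin.sum_univ_eq_sum_range (fun i => (g ⁻¹' Ioi ((i + 1 : ℝ) / n)).indicator
      (fun _ => (((n : ℝ≥0)⁻¹ : ℝ≥0) : ℝ)) x) n, Finset.sum_congr rfl fun i _ => hf i,
      ← Finset.sum_filter]
    have hle : ⌈n * g x⌉₊ - 1 ≤ n := by
      refine (Nat.sub_le _ _).trans (Nat.ceil_le.2 ?_)
      nlinarith [h1 x]
    have hfil : (Finset.range n).filter (fun i => i < ⌈n * g x⌉₊ - 1) =
        Finset.range (⌈n * g x⌉₊ - 1) := by
      ext i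
      simp only [Finset.mem_filter, Finset.mem_range]
      omega
    rw [hfil, Finset.sum_const, Finset.card_range, nsmul_eq_mul, div_eq_mul_inv]
  constructor
  · intro x
    have hx := h0 x
    refine (key x).trans_le ?_
    rw [div_le_iff₀ hn', mul_comm (g x)]
    rcases Nat.eq_zero_or_pos ⌈n * g x⌉₊ with h | h
    · rw [h]
      simpa using mul_nonneg hn'.le hx
    · have h2 : ⌈n * g x⌉₊ - 1 < ⌈n * g x⌉₊ := by omega
      exact (Nat.lt_ceil.1 h2).le
  · intro x
    refine le_of_le_of_eq ?_ (congrArg (· + 1 / (n : ℝ)) (key x)).symm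
    rw [← add_div, le_div_iff₀ hn', mul_comm (g x)]
    refine (Nat.le_ceil _).trans ?_
    have h2 : ⌈n * g x⌉₊ ≤ (⌈n * g x⌉₊ - 1) + 1 := by omega
    exact_mod_cast h2

theorem le_of_forall_le_add_inv {a b : ℝ≥0∞}
    (h : ∀ n : ℕ, 0 < n → a ≤ b + ((n : ℝ≥0)⁻¹ : ℝ≥0)) : a ≤ b := by
  refine ENNReal.le_of_forall_pos_le_add fun ε hε _ => ?_
  obtain ⟨n, hn⟩ := exists_nat_gt (ε⁻¹)
  have hn0 : 0 < n := by
    have : (0 : ℝ≥0) < n := lt_of_le_of_lt zero_le hn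
    exact_mod_cast this
  refine (h n hn0).trans (add_le_add_right (ENNReal.coe_le_coe.2 ?_) b)
  exact (inv_lt_of_inv_lt₀ hε hn).le

theorem layer_add_const_le (ν : OmegaValuation D) {s : D → ℝ} (hs : LowerSemicontinuous s)
    (h0 : ∀ x, 0 ≤ s x) {M : ℝ} (hM : ∀ x, s x ≤ M) (n : ℕ) :
    ν.layer (fun x => s x + 1 / n) ≤ ν.layer s + ((n : ℝ≥0)⁻¹ : ℝ≥0) := by
  have := ν.layer_add_indicator hs h0 hM ⊤ (n : ℝ≥0)⁻¹
  simp only [Opens.coe_top, indicator_univ, NNReal.coe_inv, NNReal.coe_natCast] at this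
  simp only [one_div, this]
  exact add_le_add_right (mul_le_of_le_one_right' (ν.le_one _)) _

theorem simple_lsc {n : ℕ} (c : Fin n → ℝ≥0) (V : Fin n → Opens D) :
    LowerSemicontinuous fun x => ∑ i, (V i : Set D).indicator (fun _ => (c i : ℝ)) x :=
  lowerSemicontinuous_sum fun i _ => (V i).isOpen.lowerSemicontinuous_indicator (c i).2

theorem layer_add (ν : OmegaValuation D) {g h : D → ℝ} (hg : LowerSemicontinuous g)
    (g0 : ∀ x, 0 ≤ g x) (g1 : ∀ x, g x ≤ 1) (hh : LowerSemicontinuous h)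
    (h0 : ∀ x, 0 ≤ h x) (h1 : ∀ x, h x ≤ 1) :
    ν.layer (fun x => g x + h x) = ν.layer g + ν.layer h := by
  refine le_antisymm (le_of_forall_le_add_inv fun n hn => ?_)
    (le_of_forall_le_add_inv fun n hn => ?_)
  all_goals
    obtain ⟨c, V, hl, hu⟩ := exists_simple hh h0 h1 n hn
    have hs0 : ∀ x, 0 ≤ ∑ i, (V i : Set D).indicator (fun _ => (c i : ℝ)) x := fun x =>
      Finset.sum_nonneg fun i _ => indicator_nonneg (fun _ _ => (c i).2) x
  · calc ν.layer (fun x => g x + h x)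
        ≤ ν.layer (fun x => (g x + ∑ i, (V i : Set D).indicator (fun _ => (c i : ℝ)) x) + 1 / n) :=
          ν.layer_mono fun x => by linarith [hu x]
      _ ≤ ν.layer (fun x => g x + ∑ i, (V i : Set D).indicator (fun _ => (c i : ℝ)) x) +
            ((n : ℝ≥0)⁻¹ : ℝ≥0) :=
          ν.layer_add_const_le (hg.add (simple_lsc c V)) (fun x => add_nonneg (g0 x) (hs0 x))
            (M := 2) (fun x => by linarith [g1 x, hl x, h1 x]) n
      _ = ν.layer g + ν.layer (fun x => ∑ i, (V i : Set D).indicator (fun _ => (c i : ℝ)) x) +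
            ((n : ℝ≥0)⁻¹ : ℝ≥0) := by
          rw [ν.layer_add_simple c V hg g0 g1, ν.layer_simple c V]
      _ ≤ ν.layer g + ν.layer h + ((n : ℝ≥0)⁻¹ : ℝ≥0) := by
          gcongr
          exact ν.layer_mono hl
  · calc ν.layer g + ν.layer h
        ≤ ν.layer g + (ν.layer (fun x => ∑ i, (V i : Set D).indicator (fun _ => (c i : ℝ)) x) +
            ((n : ℝ≥0)⁻¹ : ℝ≥0)) := by
          gcongr
          exact (ν.layer_mono hu).trans (ν.layer_add_const_le (simple_lsc c V) hs0
            (M := 1) (fun x => by linarith [hl x, h1 x]) n)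
      _ = ν.layer (fun x => g x + ∑ i, (V i : Set D).indicator (fun _ => (c i : ℝ)) x) +
            ((n : ℝ≥0)⁻¹ : ℝ≥0) := by
          rw [ν.layer_add_simple c V hg g0 g1, ν.layer_simple c V, add_assoc]
      _ ≤ ν.layer (fun x => g x + h x) + ((n : ℝ≥0)⁻¹ : ℝ≥0) := by
          gcongr
          exact ν.layer_mono fun x => by linarith [hl x]

theorem layer_le_one (ν : OmegaValuation D) {g : D → ℝ} (g1 : ∀ x, g x ≤ 1) :
    ν.layer g ≤ 1 := by
  calc ν.layer g ≤ ∫⁻ t : ℝ, (Ioc (0 : ℝ) 1).indicator 1 t := by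
        rw [layer, ← lintegral_indicator measurableSet_Ioi]
        refine lintegral_mono fun t => ?_
        by_cases ht : t ∈ Ioc (0 : ℝ) 1
        · rw [indicator_of_mem (show t ∈ Ioi (0 : ℝ) from ht.1), indicator_of_mem ht]
          exact ν.onSet_le_one _
        · by_cases h0 : t ∈ Ioi (0 : ℝ)
          · have : {x | t < g x} = ∅ := by
              ext x
              simp only [mem_ofPred_eq, mem_empty_iff_false, iff_false]
              intro hx
              exact absurd ⟨h0, hx.le.trans (g1 x)⟩ ht
            rw [indicator_of_mem h0, this, onSet_empty]
            exact zero_le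
          · rw [indicator_of_notMem h0]
            exact zero_le
    _ = 1 := by
        rw [lintegral_indicator_one measurableSet_Ioc]
        simp

theorem simple_le_iff {n : ℕ} (c : Fin n → ℝ≥0) (V : Fin n → Opens D) {g : D → ℝ≥0∞}
    (g1 : ∀ x, g x ≤ 1) (x : D) :
    ∑ i, (V i : Set D).indicator (fun _ => (c i : ℝ≥0∞)) x ≤ g x ↔
      ∑ i, (V i : Set D).indicator (fun _ => (c i : ℝ)) x ≤ (g x).toReal := by
  have h : ∑ i, (V i : Set D).indicator (fun _ => (c i : ℝ≥0∞)) x =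
      ENNReal.ofReal (∑ i, (V i : Set D).indicator (fun _ => (c i : ℝ)) x) := by
    rw [ENNReal.ofReal_sum_of_nonneg
      (f := fun i => (V i : Set D).indicator (fun _ => (c i : ℝ)) x)
      fun i _ => indicator_nonneg (fun _ _ => (c i).2) x]
    refine Finset.sum_congr rfl fun i _ => ?_
    by_cases hx : x ∈ (V i : Set D)
    · simp [hx]
    · simp [hx]
  rw [h, ENNReal.ofReal_le_iff_le_toReal (ne_top_of_le_ne_top ENNReal.one_ne_top (g1 x))]

theorem integral_eq_layer (ν : OmegaValuation D) {g : D → ℝ≥0∞} (g1 : ∀ x, g x ≤ 1)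
    (hg : LowerSemicontinuous fun x => (g x).toReal) :
    ν.integral g = ν.layer fun x => (g x).toReal := by
  refine le_antisymm ?_ (le_of_forall_le_add_inv fun n hn => ?_)
  · refine iSup_le fun n => iSup_le fun c => iSup_le fun V => iSup_le fun h => ?_
    rw [← ν.layer_simple c V]
    exact ν.layer_mono fun x => (simple_le_iff c V g1 x).1 (h x)
  · obtain ⟨c, V, hl, hu⟩ := exists_simple hg (fun _ => ENNReal.toReal_nonneg)
      (fun x => ENNReal.toReal_le_of_le_ofReal zero_le_one (by simpa using g1 x)) n hn
    have hs0 : ∀ x, 0 ≤ ∑ i, (V i : Set D).indicator (fun _ => (c i : ℝ)) x := fun x =>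
      Finset.sum_nonneg fun i _ => indicator_nonneg (fun _ _ => (c i).2) x
    refine (ν.layer_mono hu).trans ((ν.layer_add_const_le (simple_lsc c V) hs0 (M := 1)
      (fun x => (hl x).trans
        (ENNReal.toReal_le_of_le_ofReal zero_le_one (by simpa using g1 x))) n).trans ?_)
    gcongr
    rw [ν.layer_simple c V]
    exact le_iSup_of_le n (le_iSup_of_le c (le_iSup_of_le V
      (le_iSup_of_le (fun x => (simple_le_iff c V g1 x).2 (hl x)) le_rfl)))

theorem val_ne_top (ν : OmegaValuation D) (U : Opens D) : ν.val U ≠ ∞ :=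
  ne_top_of_le_ne_top ENNReal.one_ne_top (ν.le_one U)

theorem toReal_le_one (ν : OmegaValuation D) (U : Opens D) : (ν.val U).toReal ≤ 1 :=
  ENNReal.toReal_le_of_le_ofReal zero_le_one (by simpa using ν.le_one U)

theorem lsc_toReal (f : C(D, OmegaValuation E)) (U : Opens E) :
    LowerSemicontinuous fun x => ((f x).val U).toReal := by
  rw [lowerSemicontinuous_iff_isOpen_preimage]
  intro r
  by_cases hr : 0 ≤ r
  · have h : (fun x => ((f x).val U).toReal) ⁻¹' Ioi r =
        f ⁻¹' {ν | ENNReal.ofReal r < ν.val U} := by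
      ext x
      simp only [mem_preimage, mem_Ioi, mem_ofPred_eq]
      rw [ENNReal.ofReal_lt_iff_lt_toReal hr (val_ne_top _ _)]
    rw [h]
    have ho : IsOpen {ν : OmegaValuation E | ENNReal.ofReal r < ν.val U} :=
      isOpen_generateFrom_of_mem ⟨U, _, rfl⟩
    exact ho.preimage f.continuous
  · have h : (fun x => ((f x).val U).toReal) ⁻¹' Ioi r = univ :=
      eq_univ_of_forall fun x => lt_of_lt_of_le (not_le.1 hr) ENNReal.toReal_nonneg
    rw [h]
    exact isOpen_univ

theorem integral_val_eq (μ : OmegaValuation D) (f : C(D, OmegaValuation E)) (U : Opens E) :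
    μ.integral (fun x => (f x).val U) = μ.layer fun x => ((f x).val U).toReal :=
  μ.integral_eq_layer (fun x => (f x).le_one U) (lsc_toReal f U)

/-- The bind of the valuation monad: `U ↦ ∫ f x U dμ(x)`. -/
noncomputable def bind (μ : OmegaValuation D) (f : C(D, OmegaValuation E)) :
    OmegaValuation E where
  val U := μ.integral fun x => (f x).val U
  le_one U := by
    rw [integral_val_eq]
    exact μ.layer_le_one fun x => (f x).toReal_le_one U
  strict := by
    rw [integral_val_eq]
    simp only [strict, ENNReal.toReal_zero, layer_zero]
  mono U V h := by
    simp only [integral_val_eq]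
    exact μ.layer_mono fun x => ENNReal.toReal_mono (val_ne_top _ _) ((f x).mono h)
  modular U V := by
    simp only [integral_val_eq]
    rw [← μ.layer_add (lsc_toReal f U) (fun _ => ENNReal.toReal_nonneg)
        (fun x => (f x).toReal_le_one U) (lsc_toReal f V) (fun _ => ENNReal.toReal_nonneg)
        (fun x => (f x).toReal_le_one V),
      ← μ.layer_add (lsc_toReal f (U ⊔ V)) (fun _ => ENNReal.toReal_nonneg)
        (fun x => (f x).toReal_le_one _) (lsc_toReal f (U ⊓ V)) (fun _ => ENNReal.toReal_nonneg)
        (fun x => (f x).toReal_le_one _)]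
    congr 1
    ext x
    rw [← ENNReal.toReal_add (val_ne_top _ _) (val_ne_top _ _), (f x).modular,
      ENNReal.toReal_add (val_ne_top _ _) (val_ne_top _ _)]
  omega V hV := by
    simp only [integral_val_eq]
    simp only [layer]
    have hmono : ∀ x, Monotone fun n => ((f x).val (V n)).toReal := fun x m n hmn =>
      ENNReal.toReal_mono (val_ne_top _ _) ((f x).mono (hV hmn))
    rw [← lintegral_iSup (fun n => (μ.antitone_onSet' _).measurable) (fun m n hmn t =>
      μ.onSet_mono fun x hx => lt_of_lt_of_le hx (hmono x hmn))]
    refine setLIntegral_congr_fun measurableSet_Ioi fun t ht => ?_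
    dsimp only
    have ho : ∀ n, IsOpen {x | t < ((f x).val (V n)).toReal} := fun n =>
      (lsc_toReal f (V n)).isOpen_preimage t
    have h1 : {x | t < ((f x).val (⨆ n, V n)).toReal} =
        ((⨆ n, (⟨_, ho n⟩ : Opens D) : Opens D) : Set D) := by
      ext x
      simp only [Opens.coe_iSup, Opens.coe_mk, mem_iUnion, mem_ofPred_eq]
      have ht' : (0 : ℝ) ≤ t := le_of_lt ht
      simp only [← ENNReal.ofReal_lt_iff_lt_toReal ht' (val_ne_top _ _)]
      rw [(f x).omega V hV, lt_iSup_iff]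
    rw [h1, onSet_coe, μ.omega _ fun m n hmn x hx => lt_of_lt_of_le hx (hmono x hmn)]
    refine iSup_congr fun n => ?_
    rw [← onSet_coe]
    rfl

end OmegaValuation

/-! ### The pushforward of a sampler -/

/-- The event that the sampler `s` produces a value in `U`. -/
theorem isOpen_preimage_up (s : Samp D) (U : Opens D) :
    IsOpen (s ⁻¹' (Lift.up '' (U : Set D))) :=
  (Lift.isOpen_up_image U).preimage s.continuous

/-- The valuation `U ↦ fair {u | s u ∈ U}`, for `U` an open set of `D` seen inside `D_⊥`. -/
noncomputable def pushVal (s : Samp D) : OmegaValuation D where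
  val U := fair (s ⁻¹' (Lift.up '' (U : Set D)))
  le_one _ := prob_le_one
  strict := by simp
  mono _ _ h := measure_mono (preimage_mono (image_mono h))
  modular U V := by
    have hinj : Function.Injective (Lift.up : D → Lift D) := fun a b h => by injection h
    rw [Opens.coe_sup, Opens.coe_inf, image_union, image_inter hinj, preimage_union,
      preimage_inter]
    exact (measure_union_add_inter _ (isOpen_preimage_up s V).measurableSet).symm
  omega V hV := by
    rw [Opens.coe_iSup, image_iUnion, preimage_iUnion]
    exact Monotone.measure_iUnion fun m n hmn => preimage_mono (image_mono (hV hmn))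

/-- The pushforward of the fair bit-stream along a sampler, as a continuous map from samplers to
valuations. -/
noncomputable def push : C(Samp D, OmegaValuation D) where
  toFun := pushVal
  continuous_toFun := by
    refine continuous_generateFrom_iff.2 ?_
    rintro _ ⟨U, r, rfl⟩
    refine isOpen_iff_mem_nhds.2 fun s hs => ?_
    obtain ⟨K, hKs, hK, hr⟩ := (isOpen_preimage_up s U).exists_lt_isCompact (μ := fair) hs
    refine mem_of_superset
      ((ContinuousMap.isOpen_setOfPred_mapsTo hK (Lift.isOpen_up_image U)).mem_nhds hKs)
      fun s' hs' => ?_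
    exact lt_of_lt_of_le hr (measure_mono hs')

end SamplerSemantics

/-!
A deterministic sampler has a constant value, so its pushforward gives every open set measure
`0` or `1`; this is the point mass.

For sequencing, the map that splits a bit-stream into its even and odd bits carries the fair
measure to the product of two fair measures (`map_split_fair`): bits stay independent and fair
under any relabelling of their positions. Fubini's theorem therefore writes the probability that
`samp s f` lands in `U` as the integral over `u` of the probability that the sampler selected by
`s u` lands in `U` (`fair_samp_preimage`). The integrand is `0` where `s u = ⊥` and
`push (f d) U` where `s u = d`, so its superlevel sets at nonnegative levels are the preimages
under `s` of the open sets `{d | t < push (f d) U}`. The layer-cake formula for `fair` then turns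
the integral into the layer-cake integral against the valuation `push s`
(`lintegral_selected_eq_layer`), which is the value of `bind` at `U`.
-/

namespace SamplerSemantics

/-- Inverse of `split`: interleaving two streams, the first on the even positions. -/
def interleave (p : Bits × Bits) : Bits := fun n =>
  Sum.elim p.1 p.2 (Equiv.natSumNatEquivNat.symm n)

theorem interleave_natSumNatEquivNat (p : Bits × Bits) (i : ℕ ⊕ ℕ) :
    interleave p (Equiv.natSumNatEquivNat i) = Sum.elim p.1 p.2 i := by
  rw [interleave, Equiv.symm_apply_apply]

theorem split_interleave (p : Bits × Bits) : split (interleave p) = p :=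
  Prod.ext (funext fun n => interleave_natSumNatEquivNat p (Sum.inl n))
    (funext fun n => interleave_natSumNatEquivNat p (Sum.inr n))

theorem measurable_interleave : Measurable interleave := by
  refine measurable_pi_lambda _ fun n => ?_
  obtain ⟨i | i, rfl⟩ := Equiv.natSumNatEquivNat.surjective n
  · simp only [interleave_natSumNatEquivNat, Sum.elim_inl]
    fun_prop
  · simp only [interleave_natSumNatEquivNat, Sum.elim_inr]
    fun_prop

/-- Interleaving two independent fair streams gives a fair stream: on a cylinder, the product of
the one-bit probabilities factors into its even and its odd part. -/
theorem map_interleave_fair : (fair.prod fair).map interleave = fair := by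
  refine Measure.eq_infinitePi _ fun s t ht => ?_
  obtain ⟨s, rfl⟩ := Equiv.natSumNatEquivNat.finsetCongr.surjective s
  rw [Equiv.finsetCongr_apply]
  have hpre : interleave ⁻¹' Set.pi (s.map Equiv.natSumNatEquivNat.toEmbedding) t =
      (Set.pi s.toLeft fun i => t (Equiv.natSumNatEquivNat (Sum.inl i))) ×ˢ
        (Set.pi s.toRight fun i => t (Equiv.natSumNatEquivNat (Sum.inr i))) := by
    ext p
    simp only [mem_preimage, Set.mem_pi, Finset.mem_coe, Finset.forall_mem_map,
      Equiv.coe_toEmbedding, interleave_natSumNatEquivNat, mem_prod, Finset.mem_toLeft,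
      Finset.mem_toRight]
    exact Sum.forall
  rw [Measure.map_apply measurable_interleave
      (.pi (Finset.countable_toSet _) fun i _ => ht i), hpre, Measure.prod_prod, fair,
    Measure.infinitePi_pi _ fun i _ => ht _, Measure.infinitePi_pi _ fun i _ => ht _,
    Finset.prod_map, Finset.prod_sum_eq_prod_toLeft_mul_prod_toRight]
  rfl

/-- The even and the odd bits of a fair stream are independent fair streams. -/
theorem map_split_fair : fair.map split = fair.prod fair := by
  have hs : Measurable split := split.continuous.measurable
  have hid : split ∘ interleave = id := funext split_interleave
  rw [← map_interleave_fair, Measure.map_map hs measurable_interleave, hid, Measure.map_id,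
    map_interleave_fair]

variable {D : Type u} {E : Type v} [TopologicalSpace D] [TopologicalSpace E]

theorem push_det (d : D) : push (det d) = OmegaValuation.ret d := by
  ext U
  change fair ((fun _ => Lift.up d) ⁻¹' (Lift.up '' (U : Set D))) = _
  by_cases hd : d ∈ U
  · have hmem : Lift.up d ∈ Lift.up '' (U : Set D) := ⟨d, hd, rfl⟩
    simp [OmegaValuation.ret, hd, preimage_const_of_mem hmem]
  · have hmem : Lift.up d ∉ Lift.up '' (U : Set D) := by
      rintro ⟨e, he, h⟩
      cases h
      exact hd he
    simp [OmegaValuation.ret, hd, preimage_const_of_notMem hmem]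

theorem liftDom_bot_preimage (f : C(D, Samp E)) (U : Opens E) :
    liftDom f Lift.bot ⁻¹' (Lift.up '' (U : Set E)) = ∅ := by
  ext u
  constructor
  · rintro ⟨e, _, he⟩
    cases he
  · exact False.elim

/-- The event that `samp s f` lands in `U`, in terms of the two halves of the bit-stream. -/
theorem isOpen_selected (s : Samp D) (f : C(D, Samp E)) (U : Opens E) :
    IsOpen {p : Bits × Bits | liftDom f (s p.1) p.2 ∈ Lift.up '' (U : Set E)} :=
  (Lift.isOpen_up_image U).preimage
    ((liftDom f).uncurry.comp ((s.comp ContinuousMap.fst).prodMk ContinuousMap.snd)).continuous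

/-- Fubini's theorem for sequenced samplers. -/
theorem fair_samp_preimage (s : Samp D) (f : C(D, Samp E)) (U : Opens E) :
    fair (samp s f ⁻¹' (Lift.up '' (U : Set E))) =
      ∫⁻ u, fair (liftDom f (s u) ⁻¹' (Lift.up '' (U : Set E))) ∂fair := by
  have hO := (isOpen_selected s f U).measurableSet
  calc fair (samp s f ⁻¹' (Lift.up '' (U : Set E)))
      = fair.map split {p : Bits × Bits | liftDom f (s p.1) p.2 ∈ Lift.up '' (U : Set E)} :=
        (Measure.map_apply split.continuous.measurable hO).symm
    _ = _ := by
        rw [map_split_fair, Measure.prod_apply hO]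
        rfl

/-- The layer-cake formula for `fair`, seen through the sampler `s`. -/
theorem lintegral_selected_eq_layer (s : Samp D) (f : C(D, Samp E)) (U : Opens E) :
    ∫⁻ u, fair (liftDom f (s u) ⁻¹' (Lift.up '' (U : Set E))) ∂fair =
      (push s).layer fun x => ((push.comp f x).val U).toReal := by
  set G : Bits → ℝ≥0∞ := fun u => fair (liftDom f (s u) ⁻¹' (Lift.up '' (U : Set E)))
  have hG : Measurable G := measurable_measure_prodMk_left (isOpen_selected s f U).measurableSet
  have hcake := lintegral_eq_lintegral_meas_lt fair (f := fun u => (G u).toReal)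
    (.of_forall fun _ => ENNReal.toReal_nonneg) hG.ennreal_toReal.aemeasurable
  simp only [ENNReal.ofReal_toReal (measure_ne_top fair _), G] at hcake
  rw [hcake]
  refine setLIntegral_congr_fun measurableSet_Ioi fun t ht => ?_
  have hopen : IsOpen {x | t < ((push.comp f x).val U).toReal} :=
    (OmegaValuation.lsc_toReal (push.comp f) U).isOpen_preimage t
  change _ = (push s).onSet ((⟨_, hopen⟩ : Opens D) : Set D)
  rw [OmegaValuation.onSet_coe]
  change _ = fair (s ⁻¹' (Lift.up '' {x | t < ((push.comp f x).val U).toReal}))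
  congr 1
  ext u
  simp only [mem_ofPred_eq, mem_preimage]
  cases s u with
  | bot =>
    -- The integrand is `0` here, and `t` is positive.
    rw [liftDom_bot_preimage, measure_empty, ENNReal.toReal_zero]
    refine iff_of_false (not_lt.2 (le_of_lt ht)) ?_
    rintro ⟨d, _, hd⟩
    cases hd
  | up d =>
    constructor
    · exact fun h => ⟨d, h, rfl⟩
    · rintro ⟨e, he, h⟩
      cases h
      exact he

theorem push_samp (s : Samp D) (f : C(D, Samp E)) :
    push (samp s f) = (push s).bind (push.comp f) := by
  ext U
  change fair (samp s f ⁻¹' (Lift.up '' (U : Set E))) =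
    (push s).integral fun x => (push.comp f x).val U
  rw [fair_samp_preimage, lintegral_selected_eq_layer, OmegaValuation.integral_val_eq]

end SamplerSemantics

theorem mainTheorem1 {D : Type u} {E : Type v} [TopologicalSpace D] [TopologicalSpace E]
    [SamplerSemantics.QCB0Space D] [SamplerSemantics.QCB0Space E] :
    (∀ d : D, SamplerSemantics.push (SamplerSemantics.det d) =
      SamplerSemantics.OmegaValuation.ret d) ∧
    (∀ (s : SamplerSemantics.Samp D) (f : C(D, SamplerSemantics.Samp E)),
      SamplerSemantics.push (SamplerSemantics.samp s f) =
        (SamplerSemantics.push s).bind (SamplerSemantics.push.comp f)) :=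
  ⟨SamplerSemantics.push_det, SamplerSemantics.push_samp⟩
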